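/- Let $G$ be a group and let $N=(N_i)_{i\ge 1}$ be an N-series of $G$, i.e. a descending chain of subgroups $G=N_1\ge N_2\ge N_3\ge\cdots$ such that $[N_i,N_j]\subset N_{i+j}$ for all $i,j\ge 1$. Let $\mathbb F$ be a field of characteristic $p>0$. For $i\ge 1$ let $\Delta_i(N;\mathbb F)$ be the $\mathbb F$-linear subspace of the group algebra $\mathbb F[G]$ spanned by all products $(g_1-1)\cdots(g_r-1)$ with $r\ge 1$, $g_1\in N_{k_1},\dots,g_r\in N_{k_r}$, $k_1,\dots,k_r\ge 1$ and $k_1+\cdots+k_r\ge i$, and let $$D_i(N;\mathbb F):=G\cap(1+\Delta_i(N;\mathbb F))=\{g\in G : g-1\in\Delta_i(N;\mathbb F)\}$$ be the $i$-th dimension subgroup of $G$ defined by $N$ with coefficients in $\mathbb F$. Then, for all $i\ge 1$, $$D_i(N;\mathbb F)=\prod_{\substack{k\ge 1,\ j\ge 0\\ k\cdot p^j\ge i}}{N_k}^{(p^j)},$$ where, for a subgroup $H\le G$ and an integer $n\ge 1$, $H^{(n)}$ denotes the subgroup generated by all $n$-th powers of elements of $H$, and the product of the (normal) subgroups ${N_k}^{(p^j)}$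 is the set of all products of finitely many elements taken from subgroups with pairwise distinct indices $(k,j)$. -/

import Mathlib

noncomputable section

/-- An N-series `G = N 1 ≥ N 2 ≥ N 3 ≥ ⋯` of a group `G`: a descending chain of subgroups with
`[N i, N j] ≤ N (i + j)` for all `i, j ≥ 1`. Only the terms of index at least `1` are meaningful;
the term of index `0` is arbitrary and is never used. -/
structure NSeries (G : Type*) [Group G] where
  term : ℕ → Subgroup G
  term_one : term 1 = ⊤
  term_succ_le : ∀ i, 1 ≤ i → term (i + 1) ≤ term i
  commutator_le : ∀ i j, 1 ≤ i → 1 ≤ j → ⁅term i, term j⁆ ≤ term (i + j)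

namespace NSeries

variable {G : Type*} [Group G]

/-- The products `(g₁ - 1) ⋯ (gᵣ - 1)` in `R[G]` with `g₁ ∈ N k₁, …, gᵣ ∈ N kᵣ`, all `kₛ ≥ 1`, and
`k₁ + ⋯ + kᵣ ≥ i`; the list `l` consists of the pairs `(kₛ, gₛ)`. -/
def filtrationGenerators (N : NSeries G) (R : Type*) [CommRing R] (i : ℕ) :
    Set (MonoidAlgebra R G) :=
  {x | ∃ l : List (ℕ × G), (∀ t ∈ l, 1 ≤ t.1 ∧ t.2 ∈ N.term t.1) ∧
    i ≤ (l.map (fun t => t.1)).sum ∧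
    x = (l.map (fun t => MonoidAlgebra.of R G t.2 - 1)).prod}

/-- The `i`-th term `Δ_i(N; R)` of the filtration of the augmentation ideal of `R[G]` induced by
`N`, for `i ≥ 1`. -/
def filtration (N : NSeries G) (R : Type*) [CommRing R] (i : ℕ) :
    Submodule R (MonoidAlgebra R G) :=
  Submodule.span R (N.filtrationGenerators R i)

theorem filtration_mul_mem (N : NSeries G) (R : Type*) [CommRing R] {i j : ℕ}
    {x y : MonoidAlgebra R G} (hx : x ∈ N.filtration R i) (hy : y ∈ N.filtration R j) :
    x * y ∈ N.filtration R (i + j) := by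
  have h : x * y ∈ N.filtration R i * N.filtration R j := Submodule.mul_mem_mul hx hy
  rw [filtration, filtration, Submodule.span_mul_span] at h
  refine Submodule.span_mono ?_ h
  rintro _ ⟨_, ⟨l, hl, hli, rfl⟩, _, ⟨m, hm, hmj, rfl⟩, rfl⟩
  refine ⟨l ++ m, ?_, ?_, ?_⟩
  · intro t ht
    rcases List.mem_append.1 ht with h | h
    · exact hl t h
    · exact hm t h
  · simp only [List.map_append, List.sum_append]
    omega
  · simp

theorem filtration_anti (N : NSeries G) (R : Type*) [CommRing R] {i j : ℕ} (h : i ≤ j) :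
    N.filtration R j ≤ N.filtration R i := by
  refine Submodule.span_mono ?_
  rintro _ ⟨l, hl, hlj, rfl⟩
  exact ⟨l, hl, h.trans hlj, rfl⟩

theorem sub_one_mem_filtration_one (N : NSeries G) (R : Type*) [CommRing R] (g : G) :
    MonoidAlgebra.of R G g - 1 ∈ N.filtration R 1 := by
  refine Submodule.subset_span ⟨[(1, g)], ?_, ?_, ?_⟩
  · simp [N.term_one]
  · simp
  · simp

/-- The `i`-th dimension subgroup `D_i(N; R) = G ∩ (1 + Δ_i(N; R))` of `G`, for `i ≥ 1`. -/
def dimensionSubgroup (N : NSeries G) (R : Type*) [CommRing R] (i : ℕ) : Subgroup G where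
  carrier := {g | MonoidAlgebra.of R G g - 1 ∈ N.filtration R i}
  one_mem' := by
    change MonoidAlgebra.of R G 1 - 1 ∈ N.filtration R i
    rw [map_one, sub_self]
    exact zero_mem _
  mul_mem' := by
    intro a b ha hb
    have ha' : MonoidAlgebra.of R G a - 1 ∈ N.filtration R i := ha
    have hb' : MonoidAlgebra.of R G b - 1 ∈ N.filtration R i := hb
    have h := N.filtration_anti R (Nat.le_add_right i i) (N.filtration_mul_mem R ha' hb')
    have e : MonoidAlgebra.of R G (a * b) - 1 =
        (MonoidAlgebra.of R G a - 1) * (MonoidAlgebra.of R G b - 1) +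
          (MonoidAlgebra.of R G a - 1) + (MonoidAlgebra.of R G b - 1) := by
      rw [map_mul]
      noncomm_ring
    change MonoidAlgebra.of R G (a * b) - 1 ∈ N.filtration R i
    rw [e]
    exact add_mem (add_mem h ha') hb'
  inv_mem' := by
    intro a ha
    have ha' : MonoidAlgebra.of R G a - 1 ∈ N.filtration R i := ha
    have h := N.filtration_anti R (Nat.le_add_right i 1)
      (N.filtration_mul_mem R ha' (N.sub_one_mem_filtration_one R a⁻¹))
    have e0 : MonoidAlgebra.of R G a * MonoidAlgebra.of R G a⁻¹ = 1 := by
      rw [← map_mul, mul_inv_cancel, map_one]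
    have e : MonoidAlgebra.of R G a⁻¹ - 1 =
        -((MonoidAlgebra.of R G a - 1) * (MonoidAlgebra.of R G a⁻¹ - 1) +
          (MonoidAlgebra.of R G a - 1)) := by
      rw [sub_mul, mul_sub, e0]
      noncomm_ring
    change MonoidAlgebra.of R G a⁻¹ - 1 ∈ N.filtration R i
    rw [e]
    exact neg_mem (add_mem h ha')

end NSeries

/-- `H^(n)`: the subgroup generated by all `n`-th powers of elements of `H`. -/
def powerSubgroup {G : Type*} [Group G] (H : Subgroup G) (n : ℕ) : Subgroup G :=
  Subgroup.closure {y | ∃ x ∈ H, y = x ^ n}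

/-- The product `∏ t, H t` of a (possibly infinite) family of subgroups of `G`: the set of all
products `a t₁ * ⋯ * a tᵣ` of finitely many elements `a tₛ ∈ H tₛ` with pairwise distinct indices
`t₁, …, tᵣ`. When the `H t` are normal subgroups, this is a subgroup and the order of the indices
is irrelevant. -/
def subgroupProduct {G : Type*} [Group G] {ι : Type*} (H : ι → Subgroup G) : Set G :=
  {g | ∃ (l : List ι) (a : ι → G), l.Nodup ∧ (∀ t, a t ∈ H t) ∧ g = (l.map a).prod}

/-- The `i`-th term `∏_{k ≥ 1, j ≥ 0, k p^j ≥ i} (N k)^(p^j)` of the Lazard series defined by the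
N-series `N` in characteristic `p`. -/
def NSeries.lazardSeries {G : Type*} [Group G] (N : NSeries G) (p i : ℕ) : Set G :=
  subgroupProduct (fun t : {t : ℕ × ℕ // 1 ≤ t.1 ∧ i ≤ t.1 * p ^ t.2} =>
    powerSubgroup (N.term t.1.1) (p ^ t.1.2))

end

open scoped commutatorElement
open MonoidAlgebra (of supported)

/-! Let L be the Lazard series, L_i being generated by the `x ^ p ^ j` with x in N_k and k p^j ≥ i.
In characteristic p, (x - 1)^(p^j) = x^(p^j) - 1, so L_i lies in the dimension subgroup. The
converse rests on two facts.

L is again an N-series, and it is p-restricted: p-th powers of elements of L_i lie in L_{ip}. Both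
follow from collection formulas. A sequence whose k-th derivatives lie in N_{t+ak} is a product of
sequences n ↦ c_k^(n choose k) with c_k in N_{t+ak}. Such sequences form a filtered group
themselves, so the formula applies to (xy)^n and, in two variables, to [x^n, y^m]; the
p-divisibility of binomial coefficients does the rest (`commutator_lazardGenerators_mem`,
`pow_mul_mem_of_mul_le`).

If a p-restricted series M has M_m = 1, then g - 1 in Δ_m(M) forces g = 1
(`eq_one_of_sub_one_mem_delta`). Only finitely many group elements occur in a membership, and they
generate a finite group H. Take w maximal with H ≤ M_w, and a maximal proper subgroup K of H
containing H ∩ M_{w+1}, so that H is generated by K and some x with x^p in K ∩ M_{wp}. Then Δ_m(H)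
lies in the sum of the Δ_{m-aw}(K)(x - 1)^a for a < p, and comparing coefficients moves both g and
the relation g - 1 ∈ Δ_m from H down to K (`sub_one_mem_delta_of_mem_delta`).

The theorem follows by applying the second fact to the image of L in G / L_i. -/

/-- A descending chain of subgroups `N 0 ≥ N 1 ≥ ⋯` of `G` with `[N i, N j] ≤ N (i + j)` for all
`i, j ≥ 0`. -/
structure Prefiltration (G : Type*) [Group G] where
  term : ℕ → Subgroup G
  anti : Antitone term
  commutator_le : ∀ i j, ⁅term i, term j⁆ ≤ term (i + j)

/-! ### Polynomial sequences and collection formulas -/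

namespace Prefiltration

variable {G : Type*} [Group G]

theorem commutator_mem (N : Prefiltration G) {i j : ℕ} {x y : G} (hx : x ∈ N.term i)
    (hy : y ∈ N.term j) : ⁅x, y⁆ ∈ N.term (i + j) :=
  N.commutator_le i j (Subgroup.commutator_mem_commutator hx hy)

/-- The discrete derivative of a sequence in a group. -/
def diff (g : ℕ → G) : ℕ → G := fun n => (g n)⁻¹ * g (n + 1)

/-- The sequence `g` takes values in `N t`, and its `k`-th derivatives take values in
`N (t + a * k)` for all `k ≤ d`. -/
def IsPoly (N : Prefiltration G) (a : ℕ) : ℕ → ℕ → (ℕ → G) → Prop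
  | 0, t, g => ∀ n, g n ∈ N.term t
  | d + 1, t, g => (∀ n, g n ∈ N.term t) ∧ IsPoly N a d (t + a) (diff g)

namespace IsPoly

variable {N : Prefiltration G} {a : ℕ}

theorem mem {d t : ℕ} {g : ℕ → G} (h : N.IsPoly a d t g) (n : ℕ) : g n ∈ N.term t := by
  cases d with
  | zero => exact h n
  | succ d => exact h.1 n

theorem of_succ {d t : ℕ} {g : ℕ → G} (h : N.IsPoly a (d + 1) t g) : N.IsPoly a d t g := by
  induction d generalizing t g with
  | zero => exact h.1
  | succ d ih => exact ⟨h.1, ih h.2⟩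

theorem anti {d t u : ℕ} (htu : t ≤ u) {g : ℕ → G} (h : N.IsPoly a d u g) :
    N.IsPoly a d t g := by
  induction d generalizing t u g with
  | zero => exact fun n => N.anti htu (h n)
  | succ d ih => exact ⟨fun n => N.anti htu (h.1 n), ih (Nat.add_le_add_right htu a) h.2⟩

theorem one (d t : ℕ) : N.IsPoly a d t 1 := by
  induction d generalizing t with
  | zero => exact fun n => one_mem _
  | succ d ih =>
    refine ⟨fun n => one_mem _, ?_⟩
    have : diff (1 : ℕ → G) = 1 := by funext n; simp [diff]
    rw [this]
    exact ih _

/-- The three closure properties need a joint induction on the depth: the derivative of a product or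
inverse involves a conjugate, a conjugate is a commutator times the element, and the derivative of a
commutator is a product of conjugated commutators of lower depth. -/
theorem group_laws (d : ℕ) :
    (∀ t (g h : ℕ → G), N.IsPoly a d t g → N.IsPoly a d t h → N.IsPoly a d t (g * h)) ∧
    (∀ t (g : ℕ → G), N.IsPoly a d t g → N.IsPoly a d t g⁻¹) ∧
    (∀ t u (g h : ℕ → G), N.IsPoly a d t g → N.IsPoly a d u h →
      N.IsPoly a d (t + u) ⁅g, h⁆) := by
  induction d with
  | zero =>
    exact ⟨fun t g h hg hh n => mul_mem (hg n) (hh n), fun t g hg n => inv_mem (hg n),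
      fun t u g h hg hh n => N.commutator_mem (hg n) (hh n)⟩
  | succ d ih =>
    obtain ⟨hmul, hinv, hcomm⟩ := ih
    have hconj : ∀ s (b y : ℕ → G), N.IsPoly a d s b → N.IsPoly a d 0 y →
        N.IsPoly a d s (y * b * y⁻¹) := by
      intro s b y hb hy
      have e : y * b * y⁻¹ = ⁅y, b⁆ * b := by rw [commutatorElement_def]; group
      rw [e]
      exact hmul _ _ _ (by simpa using hcomm _ _ _ _ hy hb) hb
    refine ⟨?_, ?_, ?_⟩
    · intro t g h hg hh
      refine ⟨fun n => mul_mem (hg.1 n) (hh.1 n), ?_⟩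
      have e : diff (g * h) = (h⁻¹ * diff g * h⁻¹⁻¹) * diff h := by
        funext n; simp only [diff, Pi.mul_apply, Pi.inv_apply]; group
      rw [e]
      exact hmul _ _ _ (hconj _ _ _ hg.2 (hinv _ _ (hh.of_succ.anti (Nat.zero_le _)))) hh.2
    · intro t g hg
      refine ⟨fun n => inv_mem (hg.1 n), ?_⟩
      have e : diff g⁻¹ = g * (diff g)⁻¹ * g⁻¹ := by
        funext n; simp only [diff, Pi.mul_apply, Pi.inv_apply]; group
      rw [e]
      exact hconj _ _ _ (hinv _ _ hg.2) (hg.of_succ.anti (Nat.zero_le _))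
    · intro t u g h hg hh
      refine ⟨fun n => N.commutator_mem (hg.1 n) (hh.1 n), ?_⟩
      have e : diff ⁅g, h⁆ = (⁅g, h⁆⁻¹ * (g * ⁅diff g, h * diff h⁆ * g⁻¹) * ⁅g, h⁆⁻¹⁻¹) *
          (h * ⁅g, diff h⁆ * h⁻¹) := by
        funext n
        simp only [diff, Pi.mul_apply, Pi.inv_apply, commutatorElement_def]
        group
      have hg' := hg.of_succ
      have hh' := hh.of_succ
      have hg0 := hg'.anti (Nat.zero_le t)
      have hh0 := hh'.anti (Nat.zero_le u)
      have hS : N.IsPoly a d u (h * diff h) := hmul _ _ _ hh' (hh.2.anti (Nat.le_add_right _ _))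
      have hc : N.IsPoly a d 0 ⁅g, h⁆⁻¹ := hinv _ _ ((hcomm _ _ _ _ hg' hh').anti (Nat.zero_le _))
      have h1 := hcomm _ _ _ _ hg.2 hS
      have h2 := hcomm _ _ _ _ hg' hh.2
      rw [show t + a + u = t + u + a by omega] at h1
      rw [← add_assoc] at h2
      rw [e]
      exact hmul _ _ _ (hconj _ _ _ (hconj _ _ _ h1 hg0) hc) (hconj _ _ _ h2 hh0)

end IsPoly

/-- The prefiltration of polynomial sequences: the term of index `t` consists of the sequences
all of whose `k`-th derivatives take values in `N (t + a * k)`. -/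
def poly (N : Prefiltration G) (a : ℕ) : Prefiltration (ℕ → G) where
  term t :=
    { carrier := {g | ∀ d, N.IsPoly a d t g}
      one_mem' := fun d => IsPoly.one d t
      mul_mem' := fun hg hh d => (IsPoly.group_laws d).1 _ _ _ (hg d) (hh d)
      inv_mem' := fun hg d => (IsPoly.group_laws d).2.1 _ _ (hg d) }
  anti _ _ h _ hg d := (hg d).anti h
  commutator_le _ _ := Subgroup.commutator_le.2 fun _ hg _ hh d =>
    (IsPoly.group_laws d).2.2 _ _ _ _ (hg d) (hh d)

variable {N : Prefiltration G} {a : ℕ}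

theorem poly_mem {t : ℕ} {g : ℕ → G} (h : g ∈ (N.poly a).term t) (n : ℕ) : g n ∈ N.term t :=
  h 0 n

theorem diff_mem_poly {t : ℕ} {g : ℕ → G} (h : g ∈ (N.poly a).term t) :
    diff g ∈ (N.poly a).term (t + a) := fun d => (h (d + 1)).2

theorem mem_poly_of_diff {t : ℕ} {g : ℕ → G} (h : ∀ n, g n ∈ N.term t)
    (h' : diff g ∈ (N.poly a).term (t + a)) : g ∈ (N.poly a).term t := by
  intro d
  cases d with
  | zero => exact h
  | succ d => exact ⟨h, h' d⟩

theorem const_mem_poly {t : ℕ} {c : G} (hc : c ∈ N.term t) :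
    (fun _ => c) ∈ (N.poly a).term t := by
  refine mem_poly_of_diff (fun _ => hc) ?_
  have : diff (fun _ : ℕ => c) = 1 := by funext n; simp [diff]
  rw [this]
  exact one_mem _

theorem pow_choose_mem_poly {t k : ℕ} {c : G} (hc : c ∈ N.term (t + a * k)) :
    (fun n => c ^ n.choose k) ∈ (N.poly a).term t := by
  induction k generalizing t with
  | zero => simpa using const_mem_poly (a := a) (by simpa using hc)
  | succ k ih =>
    refine mem_poly_of_diff (fun n => pow_mem (N.anti (Nat.le_add_right _ _) hc) _) ?_
    have : diff (fun n : ℕ => c ^ n.choose (k + 1)) = fun n => c ^ n.choose k := by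
      funext n
      rw [diff, Nat.choose_succ_succ, Nat.add_comm (n.choose k), pow_add, inv_mul_cancel_left]
    rw [this]
    exact ih (by rwa [mul_add, mul_one, add_comm (a * k), ← add_assoc] at hc)

theorem pow_mem_poly {t : ℕ} {c : G} (hc : c ∈ N.term (t + a)) :
    (fun n => c ^ n) ∈ (N.poly a).term t := by
  simpa using pow_choose_mem_poly (N := N) (a := a) (t := t) (k := 1) (by simpa using hc)

/-- After k initial trivial values, the value at k equals the k-th derivative at 0. -/
theorem apply_mem_of_vanishing {t k : ℕ} {r : ℕ → G} (hr : r ∈ (N.poly a).term t)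
    (h : ∀ i < k, r i = 1) : r k ∈ N.term (t + a * k) := by
  induction k generalizing t r with
  | zero => simpa using poly_mem hr 0
  | succ k ih =>
    have := ih (diff_mem_poly hr) fun i hi => by
      simp [diff, h i (by omega), h (i + 1) (by omega)]
    rw [diff, h k (by omega), inv_one, one_mul] at this
    rwa [mul_add, mul_one, add_comm (a * k), ← add_assoc]

/-- A polynomial sequence is a product of sequences `n ↦ c ^ (n.choose k)`. -/
theorem apply_mem_of_pow_choose_mem {t k₀ n : ℕ} {g : ℕ → G} (hg : g ∈ (N.poly a).term t)
    (h : ∀ i < k₀, g i = 1) (W : Subgroup G)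
    (hW : ∀ k, k₀ ≤ k → k ≤ n → ∀ c ∈ N.term (t + a * k), c ^ n.choose k ∈ W) : g n ∈ W := by
  -- `r` is what remains of `g` once the factors of orders k₀, …, k₀ + j - 1 have been stripped off
  -- on the left; the next factor has base `r (k₀ + j)`.
  have key : ∀ j, k₀ + j ≤ n + 1 → ∃ r ∈ (N.poly a).term t, (∀ i < k₀ + j, r i = 1) ∧
      g n * (r n)⁻¹ ∈ W := by
    intro j
    induction j with
    | zero => exact fun _ => ⟨g, hg, h, by simp⟩
    | succ j ih =>
      intro hj
      obtain ⟨r, hr, hr1, hrW⟩ := ih (by omega)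
      have hc := apply_mem_of_vanishing hr hr1
      set c := r (k₀ + j) with hcdef
      refine ⟨(fun n => c ^ n.choose (k₀ + j))⁻¹ * r,
        mul_mem (inv_mem (pow_choose_mem_poly hc)) hr, ?_, ?_⟩
      · intro i hi
        rcases (show i < k₀ + j ∨ i = k₀ + j by omega) with hi | rfl
        · simp [hr1 i hi, Nat.choose_eq_zero_of_lt hi]
        · simp [hcdef]
      · simp only [Pi.mul_apply, Pi.inv_apply, mul_inv_rev, inv_inv, ← mul_assoc]
        exact mul_mem hrW (hW _ (by omega) (by omega) c hc)
  by_cases hk : k₀ ≤ n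
  · obtain ⟨r, -, hr1, hrW⟩ := key (n + 1 - k₀) (by omega)
    simpa [hr1 n (by omega)] using hrW
  · rw [h n (by omega)]
    exact one_mem _

variable {b : ℕ}

theorem apply_apply_mem_of_vanishing {t k l : ℕ} {r : ℕ → ℕ → G}
    (hr : r ∈ ((N.poly b).poly a).term t) (h : ∀ i < k, ∀ j ≤ l, r i j = 1)
    (h' : ∀ j < l, r k j = 1) : r k l ∈ N.term (t + a * k + b * l) := by
  induction k generalizing t r with
  | zero => simpa using apply_mem_of_vanishing (poly_mem hr 0) h'
  | succ k ih =>
    have := ih (diff_mem_poly hr)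
      (fun i hi j hj => by simp [diff, h i (by omega) j hj, h (i + 1) (by omega) j hj])
      (fun j hj => by simp [diff, h k (by omega) j hj.le, h' j hj])
    rw [diff, Pi.mul_apply, Pi.inv_apply, h k (by omega) l le_rfl, inv_one, one_mul] at this
    rwa [mul_add, mul_one, add_comm (a * k), ← add_assoc]

theorem pow_choose_mul_choose_mem_poly {t k l : ℕ} {c : G}
    (hc : c ∈ N.term (t + a * k + b * l)) :
    (fun i j => c ^ (j.choose l * i.choose k)) ∈ ((N.poly b).poly a).term t := by
  have := pow_choose_mem_poly (N := N.poly b) (pow_choose_mem_poly hc)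
  have e : (fun i j => c ^ (j.choose l * i.choose k)) =
      fun i : ℕ => (fun j : ℕ => c ^ j.choose l) ^ i.choose k := by
    funext i j
    simp [pow_mul]
  rwa [e]

theorem apply_apply_mem_of_pow_choose_mem {n m : ℕ} {g : ℕ → ℕ → G}
    (hg : g ∈ ((N.poly b).poly a).term 0) (h₁ : ∀ j, g 0 j = 1) (h₂ : ∀ i, g i 0 = 1)
    (W : Subgroup G) (hW : ∀ k l, 1 ≤ k → k ≤ n → 1 ≤ l → l ≤ m →
      ∀ c ∈ N.term (a * k + b * l), c ^ (m.choose l * n.choose k) ∈ W) : g n m ∈ W := by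
  -- Factors are stripped in lexicographic order of (k, l). The factor at (k, l) is trivial at (i,
  -- j) if i < k or j < l, so it does not disturb the points already cleared, nor the two axes.
  have outer : ∀ k ≤ n, ∃ r ∈ ((N.poly b).poly a).term 0, (∀ i ≤ k, ∀ j ≤ m, r i j = 1) ∧
      (∀ i, r i 0 = 1) ∧ g n m * (r n m)⁻¹ ∈ W := by
    intro k
    induction k with
    | zero => exact fun _ => ⟨g, hg, fun i hi j _ => by rw [Nat.le_zero.1 hi, h₁], h₂, by simp⟩
    | succ k ih =>
      intro hk
      obtain ⟨s, hs, hs1, hs0, hsW⟩ := ih (by omega)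
      have inner : ∀ l ≤ m, ∃ r ∈ ((N.poly b).poly a).term 0, (∀ i ≤ k, ∀ j ≤ m, r i j = 1) ∧
          (∀ j ≤ l, r (k + 1) j = 1) ∧ (∀ i, r i 0 = 1) ∧ g n m * (r n m)⁻¹ ∈ W := by
        intro l
        induction l with
        | zero => exact fun _ => ⟨s, hs, hs1, fun j hj => by rw [Nat.le_zero.1 hj, hs0], hs0, hsW⟩
        | succ l ih =>
          intro hl
          obtain ⟨r, hr, hr1, hrl, hr0, hrW⟩ := ih (by omega)
          have hc := apply_apply_mem_of_vanishing (k := k + 1) (l := l + 1) hr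
            (fun i hi j hj => hr1 i (by omega) j (by omega)) (fun j hj => hrl j (by omega))
          set c := r (k + 1) (l + 1) with hcdef
          refine ⟨(fun i j => c ^ (j.choose (l + 1) * i.choose (k + 1)))⁻¹ * r,
            mul_mem (inv_mem (pow_choose_mul_choose_mem_poly hc)) hr, ?_, ?_, ?_, ?_⟩
          · intro i hi j hj
            simp [hr1 i hi j hj, Nat.choose_eq_zero_of_lt (show i < k + 1 by omega)]
          · intro j hj
            rcases (show j ≤ l ∨ j = l + 1 by omega) with hj | rfl
            · simp [hrl j hj, Nat.choose_eq_zero_of_lt (show j < l + 1 by omega)]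
            · simp [hcdef]
          · intro i
            simp [hr0 i]
          · simp only [Pi.mul_apply, Pi.inv_apply, mul_inv_rev, inv_inv, ← mul_assoc]
            exact mul_mem hrW (hW _ _ (by omega) hk (by omega) hl c (by simpa using hc))
      obtain ⟨r, hr, hr1, hrl, hr0, hrW⟩ := inner m le_rfl
      refine ⟨r, hr, fun i hi j hj => ?_, hr0, hrW⟩
      rcases (show i ≤ k ∨ i = k + 1 by omega) with hi | rfl
      · exact hr1 i hi j hj
      · exact hrl j hj
  obtain ⟨r, -, hr1, -, hrW⟩ := outer n le_rfl
  simpa [hr1 n le_rfl m le_rfl] using hrW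

/-- The commutator is polynomial in n with step a and in m with step b, and it is trivial on both
axes, so only factors with k, l ≥ 1 occur. -/
theorem commutator_pow_pow_mem {x y : G} (hx : x ∈ N.term a) (hy : y ∈ N.term b) (n m : ℕ)
    (W : Subgroup G) (hW : ∀ k l, 1 ≤ k → k ≤ n → 1 ≤ l → l ≤ m →
      ∀ c ∈ N.term (a * k + b * l), c ^ (m.choose l * n.choose k) ∈ W) : ⁅x ^ n, y ^ m⁆ ∈ W := by
  have hX : (fun n : ℕ => (fun _ : ℕ => x) ^ n) ∈ ((N.poly b).poly a).term 0 :=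
    pow_mem_poly (const_mem_poly (by simpa using hx))
  have hY : (fun _ : ℕ => fun m : ℕ => y ^ m) ∈ ((N.poly b).poly a).term 0 :=
    const_mem_poly (pow_mem_poly (by simpa using hy))
  have := apply_apply_mem_of_pow_choose_mem (n := n) (m := m)
    (commutator_mem _ hX hY) (fun j => by simp [commutatorElement_def])
    (fun i => by simp [commutatorElement_def]) W hW
  simpa [commutatorElement_def] using this

end Prefiltration

/-! ### The Lazard series is a p-restricted N-series -/

/-- Here v is the p-adic valuation of k, and the divisibility comes from k (p^s choose k) = p^s (p^s
- 1 choose k - 1). -/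
theorem Nat.Prime.exists_pow_dvd_choose_pow {p : ℕ} (hp : p.Prime) {s k : ℕ} (hk : 1 ≤ k)
    (hks : k ≤ p ^ s) : ∃ v ≤ s, p ^ v ≤ k ∧ p ^ (s - v) ∣ (p ^ s).choose k := by
  have hv : p ^ k.factorization p ≤ k := Nat.ordProj_le p (by omega)
  have hvs : k.factorization p ≤ s := (Nat.pow_le_pow_iff_right hp.one_lt).1 (hv.trans hks)
  refine ⟨k.factorization p, hvs, hv, ?_⟩
  have h : p ^ s ∣ k * (p ^ s).choose k := by
    obtain ⟨n, hn⟩ : ∃ n, p ^ s = n + 1 := ⟨p ^ s - 1, by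
      have := pow_pos hp.pos s
      omega⟩
    obtain ⟨l, rfl⟩ : ∃ l, k = l + 1 := ⟨k - 1, by omega⟩
    rw [hn, mul_comm, ← Nat.add_one_mul_choose_eq]
    exact dvd_mul_right _ _
  have hcop : (p ^ s).Coprime (k / p ^ k.factorization p) :=
    Nat.Coprime.pow_left s (Nat.coprime_ordCompl hp (by omega))
  rw [← Nat.ordProj_mul_ordCompl_eq_self k p, mul_assoc, mul_left_comm] at h
  have h' := hcop.dvd_of_dvd_mul_left h
  rw [Nat.ordProj_mul_ordCompl_eq_self k p] at h'
  rw [show p ^ s = p ^ k.factorization p * p ^ (s - k.factorization p) by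
    rw [← pow_add, Nat.add_sub_cancel' hvs]] at h'
  have := Nat.dvd_of_mul_dvd_mul_left (pow_pos hp.pos _) h'
  rwa [← pow_add, Nat.add_sub_cancel' hvs] at this

/-- Modulo the normal subgroup W the condition says that images commute, which is stable under
products and inverses in either variable. -/
theorem Subgroup.commutator_closure_le {G : Type*} [Group G] {S T : Set G} (W : Subgroup G)
    [W.Normal] (h : ∀ x ∈ S, ∀ y ∈ T, ⁅x, y⁆ ∈ W) :
    ⁅Subgroup.closure S, Subgroup.closure T⁆ ≤ W := by
  have hmap : ∀ x y : G, ⁅x, y⁆ ∈ W ↔ Commute (QuotientGroup.mk' W x) (QuotientGroup.mk' W y) := by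
    intro x y
    rw [← commutatorElement_eq_one_iff_commute, ← map_commutatorElement,
      QuotientGroup.mk'_apply, QuotientGroup.eq_one_iff]
  rw [Subgroup.commutator_le]
  simp only [hmap] at h ⊢
  intro x hx y hy
  induction hx using Subgroup.closure_induction with
  | mem x hx =>
    induction hy using Subgroup.closure_induction with
    | mem y hy => exact h x hx y hy
    | one => simp
    | mul y z _ _ hy hz => rw [map_mul]; exact hy.mul_right hz
    | inv y _ hy => rw [map_inv]; exact hy.inv_right
  | one => simp
  | mul y z _ _ hy hz => rw [map_mul]; exact hy.mul_left hz
  | inv y _ hy => rw [map_inv]; exact hy.inv_left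

namespace Prefiltration

variable {G : Type*} [Group G]

theorem normal_of_eq_top (N : Prefiltration G) (h : N.term 0 = ⊤) (i : ℕ) : (N.term i).Normal := by
  refine ⟨fun x hx y => ?_⟩
  have h1 : ⁅y, x⁆ ∈ N.term (0 + i) := N.commutator_mem (h ▸ Subgroup.mem_top y) hx
  rw [zero_add] at h1
  simpa [commutatorElement_def] using mul_mem h1 hx

/-- The elements `x ^ p ^ j` with `x ∈ N k`, `k ≥ 1` and `k * p ^ j ≥ i`. -/
def lazardGenerators (N : Prefiltration G) (p i : ℕ) : Set G :=
  {g | ∃ k j x, 1 ≤ k ∧ i ≤ k * p ^ j ∧ x ∈ N.term k ∧ g = x ^ p ^ j}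

theorem lazardGenerators_anti (N : Prefiltration G) (p : ℕ) {i i' : ℕ} (h : i ≤ i') :
    N.lazardGenerators p i' ⊆ N.lazardGenerators p i := by
  rintro _ ⟨k, j, x, hk, hi, hx, rfl⟩
  exact ⟨k, j, x, hk, h.trans hi, hx, rfl⟩

theorem closure_lazardGenerators_normal (N : Prefiltration G) (h : N.term 0 = ⊤) (p i : ℕ) :
    (Subgroup.closure (N.lazardGenerators p i)).Normal := by
  refine ⟨fun g hg y => ?_⟩
  induction hg using Subgroup.closure_induction with
  | mem g hg =>
    obtain ⟨k, j, x, hk, hi, hx, rfl⟩ := hg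
    exact Subgroup.subset_closure
      ⟨k, j, y * x * y⁻¹, hk, hi, (N.normal_of_eq_top h k).conj_mem x hx y, by rw [conj_pow]⟩
  | one => simp
  | mul u v _ _ hu hv => simpa using mul_mem hu hv
  | inv u _ hu => simpa [mul_assoc] using inv_mem hu

theorem pow_mem_closure_lazardGenerators (N : Prefiltration G) {p i k j n : ℕ} {x : G}
    (hk : 1 ≤ k) (hi : i ≤ k * p ^ j) (hx : x ∈ N.term k) (hn : p ^ j ∣ n) :
    x ^ n ∈ Subgroup.closure (N.lazardGenerators p i) := by
  obtain ⟨e, rfl⟩ := hn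
  rw [pow_mul]
  exact pow_mem (Subgroup.subset_closure (show x ^ p ^ j ∈ N.lazardGenerators p i from
    ⟨k, j, x, hk, hi, hx, rfl⟩)) e

theorem commutator_lazardGenerators_mem (N : Prefiltration G) {p : ℕ} (hp : p.Prime) {i i' : ℕ}
    {g h : G} (hg : g ∈ N.lazardGenerators p i) (hh : h ∈ N.lazardGenerators p i') :
    ⁅g, h⁆ ∈ Subgroup.closure (N.lazardGenerators p (i + i')) := by
  obtain ⟨a, s, x, ha, hi, hx, rfl⟩ := hg
  obtain ⟨b, t, y, hb, hi', hy, rfl⟩ := hh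
  refine commutator_pow_pow_mem hx hy _ _ _ fun k l hk hks hl hlt c hc => ?_
  obtain ⟨v, hvs, hvk, hv⟩ := hp.exists_pow_dvd_choose_pow hk hks
  obtain ⟨w, hwt, hwl, hw⟩ := hp.exists_pow_dvd_choose_pow hl hlt
  refine N.pow_mem_closure_lazardGenerators (j := (t - w) + (s - v)) (by nlinarith) ?_ hc
    (by rw [pow_add]; exact mul_dvd_mul hw hv)
  have h1 : p ^ s = p ^ v * p ^ (s - v) := by rw [← pow_add, Nat.add_sub_cancel' hvs]
  have h2 : p ^ t = p ^ w * p ^ (t - w) := by rw [← pow_add, Nat.add_sub_cancel' hwt]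
  have h3 : 1 ≤ p ^ (s - v) := Nat.one_le_pow _ _ hp.pos
  have h4 : 1 ≤ p ^ (t - w) := Nat.one_le_pow _ _ hp.pos
  -- The weight lost through k ≥ p^v and l ≥ p^w is regained in the exponent, which is divisible by
  -- p^(s - v) p^(t - w).
  calc i + i' ≤ a * p ^ s + b * p ^ t := add_le_add hi hi'
    _ = (a * p ^ v) * (1 * p ^ (s - v)) + (b * p ^ w) * (p ^ (t - w) * 1) := by
        rw [h1, h2]; ring
    _ ≤ (a * k) * (p ^ (t - w) * p ^ (s - v)) + (b * l) * (p ^ (t - w) * p ^ (s - v)) := by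
        gcongr
    _ = (a * k + b * l) * p ^ (t - w + (s - v)) := by rw [pow_add]; ring

/-- The Lazard series of a prefiltration of `G` that starts with `G`. -/
def lazard (N : Prefiltration G) (h : N.term 0 = ⊤) {p : ℕ} (hp : p.Prime) : Prefiltration G where
  term i := Subgroup.closure (N.lazardGenerators p i)
  anti _ _ hij := Subgroup.closure_mono (N.lazardGenerators_anti p hij)
  commutator_le i j :=
    haveI := N.closure_lazardGenerators_normal h p (i + j)
    Subgroup.commutator_closure_le _ fun _ hx _ hy => N.commutator_lazardGenerators_mem hp hx hy

/-- By collection, (xy)^p is x^p y^p times powers c_k^(p choose k) with c_k in N_{ik} and 2 ≤ k ≤ p.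
For k < p the exponent is divisible by p and the claim recurs in degree ik; for k = p the element
c_p is deep enough itself. The target degree M is kept fixed so that this ascent terminates. -/
theorem pow_mul_mem_of_mul_le (N : Prefiltration G) {p : ℕ} (hp : p.Prime)
    (hgen : ∀ i, 1 ≤ i → ∃ S : Set G, N.term i = Subgroup.closure S ∧
      ∀ x ∈ S, x ^ p ∈ N.term (i * p))
    (M i : ℕ) (hi : 1 ≤ i) (hM : M ≤ i * p) {g : G} (hg : g ∈ N.term i) : g ^ p ∈ N.term M := by
  by_cases hiM : M ≤ i
  · exact pow_mem (N.anti hiM hg) p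
  obtain ⟨S, hS, hSp⟩ := hgen i hi
  have hmem : ∀ x ∈ Subgroup.closure S, x ∈ N.term (0 + i) := by simp [hS]
  rw [hS] at hg
  induction hg using Subgroup.closure_induction with
  | mem x hx => exact N.anti hM (hSp x hx)
  | one => simp
  | inv x _ hx => rw [inv_pow]; exact inv_mem hx
  | mul x y hx hy hxp hyp =>
    -- The sequence n ↦ y^(-n) x^(-n) (xy)^n is trivial at 0 and 1, hence k₀ = 2.
    have h := apply_mem_of_pow_choose_mem (k₀ := 2) (n := p)
      (mul_mem (mul_mem (inv_mem (pow_mem_poly (hmem y hy))) (inv_mem (pow_mem_poly (hmem x hx))))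
        (pow_mem_poly (mul_mem (hmem x hx) (hmem y hy)))) (fun j hj => by
          interval_cases j <;> simp [mul_assoc]) (N.term M) (fun k hk hkp c hc => by
          rw [zero_add] at hc
          rcases hkp.lt_or_eq with hkp | rfl
          · obtain ⟨e, he⟩ := hp.dvd_choose_self (by omega) hkp
            rw [he, pow_mul]
            refine pow_mem (N.pow_mul_mem_of_mul_le hp hgen M (i * k) (by nlinarith) ?_ hc) e
            nlinarith [hp.pos]
          · exact pow_mem (N.anti hM hc) _)
    have := mul_mem (mul_mem hxp hyp) h
    simpa [mul_assoc] using this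
termination_by M - i
decreasing_by
  have : i * 2 ≤ i * k := Nat.mul_le_mul_left i hk
  omega

theorem pow_mem_lazard (N : Prefiltration G) (h : N.term 0 = ⊤) {p : ℕ} (hp : p.Prime) {i : ℕ}
    (hi : 1 ≤ i) {g : G} (hg : g ∈ (N.lazard h hp).term i) :
    g ^ p ∈ (N.lazard h hp).term (i * p) := by
  refine pow_mul_mem_of_mul_le _ hp (fun i _ => ⟨_, rfl, ?_⟩) _ i hi le_rfl hg
  rintro _ ⟨k, j, x, hk, hi, hx, rfl⟩
  refine Subgroup.subset_closure ⟨k, j + 1, x, hk, ?_, hx, by rw [pow_succ, pow_mul]⟩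
  rw [pow_succ, ← mul_assoc]
  exact Nat.mul_le_mul_right p hi

end Prefiltration

/-! ### Independence of the powers of x - 1 over the group algebra of K -/

namespace MonoidAlgebra

variable {F G : Type*} [Field F] [Group G] {K : Subgroup G} {x : G} {p : ℕ}

theorem of_mul_mem_supported {h : G} (hh : h ∈ K) {u : MonoidAlgebra F G}
    (hu : u ∈ supported F F (K : Set G)) : of F G h * u ∈ supported F F (K : Set G) := by
  rw [mem_supported'] at hu ⊢
  intro m hm
  rw [of_apply, coeff_single_mul_apply, one_mul]
  exact hu _ fun hm' => hm (by simpa using mul_mem hh hm')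

/-- The element u (x - 1)^a is supported on the cosets K x^c with c ≤ a, and its part on the top
coset is u x^a. This triangularity gives linear independence, with the highest power treated first.
-/
theorem coeff_mul_sub_one_pow (hx : ∀ b, 0 < b → b < p → x ^ b ∉ K) {u : MonoidAlgebra F G}
    (hu : u ∈ supported F F (K : Set G)) {a b : ℕ} (hab : a ≤ b) (hb : b < p) {h : G}
    (hh : h ∈ K) :
    (u * (of F G x - 1) ^ a).coeff (h * x ^ b) = if a = b then u.coeff h else 0 := by
  induction a generalizing b with
  | zero =>
    rcases Nat.eq_zero_or_pos b with rfl | hb0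
    · simp
    · rw [pow_zero, mul_one, if_neg (by omega)]
      refine mem_supported'.1 hu _ fun hm => hx b hb0 hb ?_
      exact (Subgroup.mul_mem_cancel_left K hh).1 hm
  | succ a ih =>
    obtain ⟨b, rfl⟩ : ∃ c, b = c + 1 := ⟨b - 1, by omega⟩
    rw [pow_succ, ← mul_assoc, mul_sub, mul_one, coeff_sub, Finsupp.sub_apply, of_apply,
      coeff_mul_single_apply, mul_one, ← of_apply, ih (by omega) hb, if_neg (by omega), sub_zero,
      pow_succ, ← mul_assoc, mul_inv_cancel_right, ih (by omega) (by omega)]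
    simp

theorem eq_zero_of_sum_mul_sub_one_pow_eq_zero (hx : ∀ b, 0 < b → b < p → x ^ b ∉ K)
    {u : ℕ → MonoidAlgebra F G} (hu : ∀ a, u a ∈ supported F F (K : Set G)) {n : ℕ} (hn : n ≤ p)
    (h0 : ∑ a ∈ Finset.range n, u a * (of F G x - 1) ^ a = 0) : ∀ a < n, u a = 0 := by
  induction n with
  | zero => simp
  | succ n ih =>
    have hun : u n = 0 := by
      rw [← coeff_eq_zero]
      ext h
      by_cases hh : h ∈ K
      · have := congrArg (fun y => y.coeff (h * x ^ n)) h0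
        simp only [Finset.sum_range_succ, coeff_add, coeff_sum, Finsupp.add_apply,
          Finsupp.finsetSum_apply] at this
        rw [Finset.sum_eq_zero, zero_add, coeff_mul_sub_one_pow hx (hu n) le_rfl hn hh] at this
        · simpa using this
        · intro a ha
          have := Finset.mem_range.1 ha
          rw [coeff_mul_sub_one_pow hx (hu a) this.le hn hh, if_neg this.ne]
      · exact mem_supported'.1 (hu n) h hh
    rw [Finset.sum_range_succ, hun, zero_mul, add_zero] at h0
    intro a ha
    rcases Nat.lt_succ_iff_lt_or_eq.1 ha with ha | rfl
    · exact ih (by omega) h0 a ha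
    · exact hun

end MonoidAlgebra

/-! ### The filtration on the group algebra of a subgroup -/

namespace Prefiltration

variable {G : Type*} [Group G]

/-- The span of the products `(g₁ - 1) ⋯ (gᵣ - 1)` with `g₁ ∈ N k₁ ⊓ K, …, gᵣ ∈ N kᵣ ⊓ K`, all
`kₛ ≥ 1`, and `k₁ + ⋯ + kᵣ ≥ i`. -/
noncomputable def delta (N : Prefiltration G) (F : Type*) [Field F] (K : Subgroup G) (i : ℕ) :
    Submodule F (MonoidAlgebra F G) :=
  Submodule.span F {x | ∃ l : List (ℕ × G),
    (∀ t ∈ l, 1 ≤ t.1 ∧ t.2 ∈ N.term t.1 ∧ t.2 ∈ K) ∧ i ≤ (l.map (fun t => t.1)).sum ∧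
    x = (l.map (fun t => of F G t.2 - 1)).prod}

variable {N : Prefiltration G} {F : Type*} [Field F] {K H : Subgroup G}

theorem delta_anti {i j : ℕ} (h : i ≤ j) : N.delta F K j ≤ N.delta F K i := by
  refine Submodule.span_mono ?_
  rintro _ ⟨l, hl, hlj, rfl⟩
  exact ⟨l, hl, h.trans hlj, rfl⟩

theorem delta_mono (h : K ≤ H) (i : ℕ) : N.delta F K i ≤ N.delta F H i := by
  refine Submodule.span_mono ?_
  rintro _ ⟨l, hl, hli, rfl⟩
  exact ⟨l, fun t ht => ⟨(hl t ht).1, (hl t ht).2.1, h (hl t ht).2.2⟩, hli, rfl⟩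

theorem mul_mem_delta {i j : ℕ} {y z : MonoidAlgebra F G} (hy : y ∈ N.delta F K i)
    (hz : z ∈ N.delta F K j) : y * z ∈ N.delta F K (i + j) := by
  have h := Submodule.mul_mem_mul hy hz
  rw [delta, delta, Submodule.span_mul_span] at h
  refine Submodule.span_mono ?_ h
  rintro _ ⟨_, ⟨l, hl, hli, rfl⟩, _, ⟨m, hm, hmj, rfl⟩, rfl⟩
  refine ⟨l ++ m, ?_, ?_, by simp⟩
  · intro t ht
    rcases List.mem_append.1 ht with h | h
    · exact hl t h
    · exact hm t h
  · simp only [List.map_append, List.sum_append]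
    omega

theorem one_mem_delta : (1 : MonoidAlgebra F G) ∈ N.delta F K 0 :=
  Submodule.subset_span ⟨[], by simp, by simp, by simp⟩

theorem sub_one_mem_delta {k : ℕ} (hk : 1 ≤ k) {g : G} (hg : g ∈ N.term k) (hgK : g ∈ K) :
    of F G g - 1 ∈ N.delta F K k :=
  Submodule.subset_span ⟨[(k, g)], by simp [hk, hg, hgK], by simp, by simp⟩

theorem of_mem_delta (hK : K ≤ N.term 1) {g : G} (hg : g ∈ K) : of F G g ∈ N.delta F K 0 := by
  have h := delta_anti (Nat.zero_le 1) (sub_one_mem_delta (F := F) le_rfl (hK hg) hg)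
  simpa using add_mem h one_mem_delta

theorem delta_le_supported (i : ℕ) : N.delta F K i ≤ supported F F (K : Set G) := by
  refine Submodule.span_le.2 ?_
  rintro _ ⟨l, hl, -, rfl⟩
  induction l with
  | nil =>
    refine MonoidAlgebra.mem_supported'.2 fun m hm => ?_
    have : m ≠ 1 := fun h => hm (h ▸ one_mem K)
    simp [MonoidAlgebra.one_def, this]
  | cons t l ih =>
    have ih := ih fun s hs => hl s (List.mem_cons_of_mem _ hs)
    simp only [List.map_cons, List.prod_cons, sub_mul, one_mul]
    exact sub_mem (MonoidAlgebra.of_mul_mem_supported (hl t List.mem_cons_self).2.2 ih) ih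

theorem sum_coeff_eq_zero_of_mem_delta {i : ℕ} (hi : 1 ≤ i) {y : MonoidAlgebra F G}
    (hy : y ∈ N.delta F K i) : MonoidAlgebra.lift F F G (1 : G →* F) y = 0 := by
  induction hy using Submodule.span_induction with
  | mem y hy =>
    obtain ⟨l, hl, hli, rfl⟩ := hy
    cases l with
    | nil => simp at hli; omega
    | cons t l => simp
  | zero => simp
  | add y z _ _ hy hz => rw [map_add, hy, hz, add_zero]
  | smul c y _ hy => rw [map_smul, hy, smul_zero]

/-- The gain of w comes from x g x⁻¹ - g = ([x, g] - 1) g, where the commutator lies in K and in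
N_{w+k}. -/
theorem conj_sub_one_mem_delta {x : G} (hx : ∀ k ∈ K, x * k * x⁻¹ ∈ K)
    (hN : ∀ k, (N.term k).Normal) (hK : K ≤ N.term 1) {w : ℕ} (hxw : x ∈ N.term w) {k : ℕ}
    (hk : 1 ≤ k) {g : G} (hg : g ∈ N.term k) (hgK : g ∈ K) :
    of F G (x * g * x⁻¹) - 1 ∈ N.delta F K k ∧
      of F G (x * g * x⁻¹) - of F G g ∈ N.delta F K (w + k) := by
  refine ⟨sub_one_mem_delta hk ((hN _).conj_mem _ hg x) (hx _ hgK), ?_⟩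
  have e : of F G (x * g * x⁻¹) - of F G g = (of F G ⁅x, g⁆ - 1) * of F G g := by
    rw [sub_mul, ← map_mul, one_mul, commutatorElement_def, inv_mul_cancel_right]
  rw [e]
  have h1 : ⁅x, g⁆ ∈ K := by
    rw [commutatorElement_def]
    exact mul_mem (hx _ hgK) (inv_mem hgK)
  have h2 : of F G ⁅x, g⁆ - 1 ∈ N.delta F K (w + k) :=
    sub_one_mem_delta (hk.trans (Nat.le_add_left k w)) (N.commutator_mem hxw hg) h1
  have h3 := mul_mem_delta h2 (of_mem_delta hK hgK)
  rwa [add_zero] at h3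

theorem of_mul_mul_of_inv (x : G) (u v : MonoidAlgebra F G) :
    of F G x * (u * v) * of F G x⁻¹ =
      (of F G x * u * of F G x⁻¹) * (of F G x * v * of F G x⁻¹) := by
  have hxx : of F G x⁻¹ * of F G x = 1 := by rw [← map_mul, inv_mul_cancel, map_one]
  simp only [mul_assoc]
  rw [← mul_assoc (of F G x⁻¹) (of F G x), hxx, one_mul]

theorem conj_prod_mem_delta {x : G} (hx : ∀ k ∈ K, x * k * x⁻¹ ∈ K)
    (hN : ∀ k, (N.term k).Normal) (hK : K ≤ N.term 1) {w : ℕ} (hxw : x ∈ N.term w)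
    {l : List (ℕ × G)} (hl : ∀ t ∈ l, 1 ≤ t.1 ∧ t.2 ∈ N.term t.1 ∧ t.2 ∈ K) :
    of F G x * (l.map (fun t => of F G t.2 - 1)).prod * of F G x⁻¹ ∈
        N.delta F K (l.map (fun t => t.1)).sum ∧
      of F G x * (l.map (fun t => of F G t.2 - 1)).prod * of F G x⁻¹ -
        (l.map (fun t => of F G t.2 - 1)).prod ∈ N.delta F K ((l.map (fun t => t.1)).sum + w) := by
  have hxx : of F G x * of F G x⁻¹ = 1 := by rw [← map_mul, mul_inv_cancel, map_one]
  induction l with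
  | nil =>
    simp only [List.map_nil, List.prod_nil, mul_one, List.sum_nil]
    rw [hxx, sub_self]
    exact ⟨one_mem_delta, zero_mem _⟩
  | cons t l ih =>
    have hl' := fun s hs => hl s (List.mem_cons_of_mem _ hs)
    obtain ⟨ih1, ih2⟩ := ih hl'
    obtain ⟨ht1, htN, htK⟩ := hl t List.mem_cons_self
    have hP : (l.map (fun t => of F G t.2 - 1)).prod ∈ N.delta F K (l.map (fun t => t.1)).sum :=
      Submodule.subset_span ⟨l, hl', le_rfl, rfl⟩
    simp only [List.map_cons, List.prod_cons, List.sum_cons]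
    generalize (l.map (fun t => of F G t.2 - 1)).prod = P at ih1 ih2 hP ⊢
    generalize (l.map (fun t => t.1)).sum = n at ih1 ih2 hP ⊢
    obtain ⟨h1, h2⟩ := conj_sub_one_mem_delta (F := F) hx hN hK hxw ht1 htN htK
    have e0 : of F G x * (of F G t.2 - 1) * of F G x⁻¹ = of F G (x * t.2 * x⁻¹) - 1 := by
      rw [mul_sub, sub_mul, mul_one, ← map_mul, ← map_mul, hxx]
    rw [of_mul_mul_of_inv, e0]
    refine ⟨mul_mem_delta h1 ih1, ?_⟩
    generalize of F G x * P * of F G x⁻¹ = P' at ih1 ih2 ⊢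
    generalize of F G (x * t.2 * x⁻¹) = y at h1 h2 ⊢
    generalize of F G t.2 = z at h1 h2 ⊢
    have e3 : (y - 1) * P' - (z - 1) * P = (y - 1) * (P' - P) + (y - z) * P := by noncomm_ring
    have h3 := mul_mem_delta h1 ih2
    have h4 := mul_mem_delta h2 hP
    rw [← add_assoc] at h3
    rw [show w + t.1 + n = t.1 + n + w by omega] at h4
    rw [e3]
    exact add_mem h3 h4

theorem conj_mem_delta {x : G} (hx : ∀ k ∈ K, x * k * x⁻¹ ∈ K)
    (hN : ∀ k, (N.term k).Normal) (hK : K ≤ N.term 1) {w : ℕ} (hxw : x ∈ N.term w) {i : ℕ}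
    {u : MonoidAlgebra F G} (hu : u ∈ N.delta F K i) :
    of F G x * u * of F G x⁻¹ ∈ N.delta F K i ∧
      of F G x * u * of F G x⁻¹ - u ∈ N.delta F K (i + w) := by
  induction hu using Submodule.span_induction with
  | mem u hu =>
    obtain ⟨l, hl, hli, rfl⟩ := hu
    obtain ⟨h1, h2⟩ := conj_prod_mem_delta (F := F) hx hN hK hxw hl
    exact ⟨delta_anti hli h1, delta_anti (Nat.add_le_add_right hli w) h2⟩
  | zero => simp
  | add y z _ _ hy hz =>
    rw [mul_add, add_mul, add_sub_add_comm]
    exact ⟨add_mem hy.1 hz.1, add_mem hy.2 hz.2⟩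
  | smul c y _ hy =>
    rw [mul_smul_comm, smul_mul_assoc, ← smul_sub]
    exact ⟨Submodule.smul_mem _ _ hy.1, Submodule.smul_mem _ _ hy.2⟩

end Prefiltration

/-! ### Passing from K to H by adjoining one element -/

namespace Prefiltration

variable {G : Type*} [Group G]

/-- The sum of the spaces `delta K (i - a * w) * (x - 1) ^ a` for `a < p`. -/
noncomputable def deltaExtend (N : Prefiltration G) (F : Type*) [Field F] (K : Subgroup G) (x : G)
    (w p i : ℕ) :
    Submodule F (MonoidAlgebra F G) :=
  Submodule.span F {y | ∃ a < p, ∃ u ∈ N.delta F K (i - a * w), y = u * (of F G x - 1) ^ a}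

/-- The data of a subgroup `H ≤ N w` generated by a subgroup `K` that contains `H ⊓ N (w + 1)`
and by an element `x` whose `p`-th power is the first to lie in `K`. -/
structure IsStep (N : Prefiltration G) (p w : ℕ) (K H : Subgroup G) (x : G) : Prop where
  one_le : 1 ≤ w
  le_term : H ≤ N.term w
  le : K ≤ H
  mem : x ∈ H
  mem_of_mem : ∀ g ∈ H, g ∈ N.term (w + 1) → g ∈ K
  pow_mem : x ^ p ∈ K
  pow_mem_term : x ^ p ∈ N.term (w * p)
  pow_notMem : ∀ b, 0 < b → b < p → x ^ b ∉ K
  exists_eq : ∀ g ∈ H, ∃ b < p, ∃ h ∈ K, g = h * x ^ b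

namespace IsStep

variable {N : Prefiltration G} {F : Type*} [Field F] {K H : Subgroup G} {x : G} {p w : ℕ}

theorem deltaExtend_anti {i j : ℕ} (h : i ≤ j) :
    N.deltaExtend F K x w p j ≤ N.deltaExtend F K x w p i := by
  refine Submodule.span_mono ?_
  rintro _ ⟨a, ha, u, hu, rfl⟩
  exact ⟨a, ha, u, delta_anti (Nat.sub_le_sub_right h _) hu, rfl⟩

theorem mem_deltaExtend {i a : ℕ} (ha : a < p) {u : MonoidAlgebra F G}
    (hu : u ∈ N.delta F K (i - a * w)) :
    u * (of F G x - 1) ^ a ∈ N.deltaExtend F K x w p i :=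
  Submodule.subset_span ⟨a, ha, u, hu, rfl⟩

theorem exists_eq_sum {i : ℕ} {y : MonoidAlgebra F G} (hy : y ∈ N.deltaExtend F K x w p i) :
    ∃ u : ℕ → MonoidAlgebra F G, (∀ a, u a ∈ N.delta F K (i - a * w)) ∧
      y = ∑ a ∈ Finset.range p, u a * (of F G x - 1) ^ a := by
  induction hy using Submodule.span_induction with
  | mem y hy =>
    obtain ⟨a, ha, u, hu, rfl⟩ := hy
    refine ⟨fun b => if b = a then u else 0, fun b => ?_, ?_⟩
    · dsimp only
      split_ifs with h
      · exact h ▸ hu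
      · exact zero_mem _
    · simp [ite_mul, ha]
  | zero => exact ⟨0, fun _ => zero_mem _, by simp⟩
  | add y z _ _ hy hz =>
    obtain ⟨u, hu, rfl⟩ := hy
    obtain ⟨v, hv, rfl⟩ := hz
    exact ⟨u + v, fun a => add_mem (hu a) (hv a), by simp [add_mul, Finset.sum_add_distrib]⟩
  | smul c y _ hy =>
    obtain ⟨u, hu, rfl⟩ := hy
    exact ⟨c • u, fun a => Submodule.smul_mem _ _ (hu a), by simp [Finset.smul_sum]⟩

theorem mul_mem_deltaExtend {k i : ℕ} {c y : MonoidAlgebra F G} (hc : c ∈ N.delta F K k)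
    (hy : y ∈ N.deltaExtend F K x w p i) : c * y ∈ N.deltaExtend F K x w p (k + i) := by
  induction hy using Submodule.span_induction with
  | mem y hy =>
    obtain ⟨a, ha, u, hu, rfl⟩ := hy
    rw [← mul_assoc]
    exact mem_deltaExtend ha (delta_anti (by omega) (mul_mem_delta hc hu))
  | zero => simp
  | add y z _ _ hy hz => rw [mul_add]; exact add_mem hy hz
  | smul c y _ hy => rw [mul_smul_comm]; exact Submodule.smul_mem _ _ hy

/-- With v = x u x⁻¹ one has (x - 1) u = v (x - 1) + (v - u). The first term has one more power of x
- 1, and in the second v - u has gained weight w. -/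
theorem sub_one_mul_mem_deltaExtend (h : N.IsStep p w K H x) (hN : ∀ k, (N.term k).Normal)
    [CharP F p] (hp : p.Prime) {i : ℕ} {y : MonoidAlgebra F G}
    (hy : y ∈ N.deltaExtend F K x w p i) :
    (of F G x - 1) * y ∈ N.deltaExtend F K x w p (w + i) := by
  have hcommK : ∀ k ∈ K, ⁅x, k⁆ ∈ K := fun k hk => by
    refine h.mem_of_mem _ ?_ (N.anti (Nat.add_le_add_left h.one_le w)
      (N.commutator_mem (h.le_term h.mem) (h.le_term (h.le hk))))
    rw [commutatorElement_def]
    exact mul_mem (mul_mem (mul_mem h.mem (h.le hk)) (inv_mem h.mem)) (inv_mem (h.le hk))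
  have hconj : ∀ k ∈ K, x * k * x⁻¹ ∈ K := fun k hk => by
    simpa [commutatorElement_def] using mul_mem (hcommK k hk) hk
  have hK1 : K ≤ N.term 1 := h.le.trans (h.le_term.trans (N.anti h.one_le))
  have hxx : of F G x⁻¹ * of F G x = 1 := by rw [← map_mul, inv_mul_cancel, map_one]
  have : Fact p.Prime := ⟨hp⟩
  have : CharP (MonoidAlgebra F G) p :=
    charP_of_injective_algebraMap (algebraMap F (MonoidAlgebra F G)).injective p
  induction hy using Submodule.span_induction with
  | mem y hy =>
    obtain ⟨a, ha, u, hu, rfl⟩ := hy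
    obtain ⟨hu1, hu2⟩ := conj_mem_delta hconj hN hK1 (h.le_term h.mem) hu
    set v := of F G x * u * of F G x⁻¹
    have e : (of F G x - 1) * (u * (of F G x - 1) ^ a) =
        v * (of F G x - 1) ^ (a + 1) + (v - u) * (of F G x - 1) ^ a := by
      have : v * of F G x = of F G x * u := by rw [mul_assoc, hxx, mul_one]
      rw [pow_succ', ← mul_assoc, ← mul_assoc, ← add_mul, mul_sub, this, sub_mul]
      congr 1
      noncomm_ring
    rw [e]
    refine add_mem ?_ (mem_deltaExtend ha (delta_anti (by omega) hu2))
    rcases (show a + 1 < p ∨ a + 1 = p by omega) with ha' | ha'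
    · refine mem_deltaExtend ha' (delta_anti ?_ hu1)
      rw [add_mul]; omega
    -- The exponent has reached p: (x - 1)^p = x^p - 1 lies in Δ_{wp}(K), so it is absorbed into the
    -- coefficient of (x - 1)^0.
    · rw [ha', sub_pow_char_of_commute (p := p) (Commute.one_right (of F G x)), one_pow, ← map_pow]
      have := mul_mem_delta hu1 (sub_one_mem_delta (F := F) (by nlinarith [h.one_le, hp.pos])
        h.pow_mem_term h.pow_mem)
      have hm := mem_deltaExtend (N := N) (w := w) (x := x) (i := w + i) hp.pos
        (delta_anti (i := w + i - 0 * w) ?_ this)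
      · simpa using hm
      · rw [← ha', mul_add, mul_one, mul_comm w a]; omega
  | zero => simp
  | add y z _ _ hy hz => rw [mul_add]; exact add_mem hy hz
  | smul c y _ hy => rw [mul_smul_comm]; exact Submodule.smul_mem _ _ hy

theorem of_sub_one_mul_mem_deltaExtend (h : N.IsStep p w K H x) (hN : ∀ k, (N.term k).Normal)
    [CharP F p] (hp : p.Prime) {g : G} (hg : g ∈ H) {i : ℕ} {y : MonoidAlgebra F G}
    (hy : y ∈ N.deltaExtend F K x w p i) :
    (of F G g - 1) * y ∈ N.deltaExtend F K x w p (w + i) := by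
  have hmul : ∀ g h : G,
      (∀ y ∈ N.deltaExtend F K x w p i, (of F G g - 1) * y ∈ N.deltaExtend F K x w p (w + i)) →
      (∀ y ∈ N.deltaExtend F K x w p i, (of F G h - 1) * y ∈ N.deltaExtend F K x w p (w + i)) →
      ∀ y ∈ N.deltaExtend F K x w p i,
        (of F G (g * h) - 1) * y ∈ N.deltaExtend F K x w p (w + i) := by
    intro g h hg hh y hy
    have e : (of F G (g * h) - 1) * y = (of F G g - 1) * ((of F G h - 1) * y) +
        (of F G g - 1) * y + (of F G h - 1) * y := by
      rw [map_mul]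
      noncomm_ring
    rw [e]
    exact add_mem (add_mem (hg _ (deltaExtend_anti (Nat.le_add_left i w) (hh y hy))) (hg y hy))
      (hh y hy)
  obtain ⟨b, -, k, hk, rfl⟩ := h.exists_eq g hg
  refine hmul _ _ (fun y hy => mul_mem_deltaExtend
    (sub_one_mem_delta h.one_le (h.le_term (h.le hk)) hk) hy) ?_ y hy
  clear hg
  induction b with
  | zero =>
    intro y _
    rw [pow_zero, map_one, sub_self, zero_mul]
    exact zero_mem _
  | succ b ih =>
    rw [pow_succ]
    exact hmul _ _ ih fun y hy => h.sub_one_mul_mem_deltaExtend hN hp hy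

/-- Multiplying by g - 1 on the left raises the degree by w for every g in H, which suffices for
factors of weight at most w. A factor of larger weight lies in K by `mem_of_mem` and contributes its
full weight to the coefficients. -/
theorem delta_le_deltaExtend (h : N.IsStep p w K H x) (hN : ∀ k, (N.term k).Normal)
    [CharP F p] (hp : p.Prime) (i : ℕ) : N.delta F H i ≤ N.deltaExtend F K x w p i := by
  refine Submodule.span_le.2 ?_
  rintro _ ⟨l, hl, hli, rfl⟩
  refine deltaExtend_anti hli ?_
  clear hli
  induction l with
  | nil =>
    have h1 : (1 : MonoidAlgebra F G) ∈ N.delta F K (0 - 0 * w) :=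
      delta_anti (Nat.sub_le 0 _) one_mem_delta
    simpa using mem_deltaExtend (x := x) hp.pos h1
  | cons t l ih =>
    have ih := ih fun s hs => hl s (List.mem_cons_of_mem _ hs)
    obtain ⟨ht1, htN, htH⟩ := hl t List.mem_cons_self
    simp only [List.map_cons, List.prod_cons, List.sum_cons]
    by_cases htw : t.1 ≤ w
    · exact deltaExtend_anti (by omega) (h.of_sub_one_mul_mem_deltaExtend hN hp htH ih)
    · exact mul_mem_deltaExtend (sub_one_mem_delta ht1 htN
        (h.mem_of_mem _ htH (N.anti (by omega) htN))) ih

/-- Write g = k x^b, so that g is the sum of the (b choose a) k (x - 1)^a, and compare coefficients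
with an expansion of g - 1 in `deltaExtend`. The coefficient at a = 1 forces b = 0; the one at a = 0
then gives the claim. -/
theorem sub_one_mem_delta_of_mem_delta (h : N.IsStep p w K H x) (hN : ∀ k, (N.term k).Normal)
    [CharP F p] (hp : p.Prime) {m : ℕ} (hm : w < m) {g : G} (hg : g ∈ H)
    (hgm : of F G g - 1 ∈ N.delta F H m) : g ∈ K ∧ of F G g - 1 ∈ N.delta F K m := by
  obtain ⟨u, hu, hgu⟩ := exists_eq_sum (h.delta_le_deltaExtend hN hp m hgm)
  obtain ⟨b, hb, k, hk, rfl⟩ := h.exists_eq g hg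
  have hK1 : K ≤ N.term 1 := h.le.trans (h.le_term.trans (N.anti h.one_le))
  have hkK : of F G k ∈ supported F F (K : Set G) :=
    delta_le_supported 0 (of_mem_delta (N := N) hK1 hk)
  have h1K : (1 : MonoidAlgebra F G) ∈ supported F F (K : Set G) :=
    delta_le_supported 0 (one_mem_delta (N := N))
  have hexp : of F G (k * x ^ b) = ∑ a ∈ Finset.range p,
      ((b.choose a : F) • of F G k) * (of F G x - 1) ^ a := by
    have hx : of F G x = (of F G x - 1) + 1 := by abel
    rw [map_mul, map_pow, hx, (Commute.one_right (of F G x - 1)).add_pow, Finset.mul_sum,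
      ← hx]
    refine Finset.sum_subset_zero_on_sdiff (Finset.range_subset_range.2 hb) ?_ ?_
    · intro a ha
      have := (Finset.mem_sdiff.1 ha).2
      rw [Nat.choose_eq_zero_of_lt (by simpa using this)]
      simp
    · intro a _
      rw [one_pow, mul_one, smul_mul_assoc, ← mul_assoc, ← nsmul_eq_mul', Nat.cast_smul_eq_nsmul]
  have hzero : ∑ a ∈ Finset.range p,
      ((b.choose a : F) • of F G k - (if a = 0 then 1 else 0) - u a) * (of F G x - 1) ^ a = 0 := by
    simp only [sub_mul, Finset.sum_sub_distrib]
    rw [← hexp, ← hgu]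
    simp [ite_mul, hp.pos]
  have hcoef := MonoidAlgebra.eq_zero_of_sum_mul_sub_one_pow_eq_zero h.pow_notMem
    (fun a => sub_mem (sub_mem (Submodule.smul_mem _ _ hkK) (by
      split_ifs
      · exact h1K
      · exact zero_mem _)) (delta_le_supported _ (hu a))) le_rfl hzero
  have h0 := sub_eq_zero.1 (hcoef 0 hp.pos)
  have h1 := sub_eq_zero.1 (hcoef 1 hp.one_lt)
  -- The coefficient b k lies in Δ_{m-w}(K) with m - w ≥ 1, so its augmentation b vanishes in F; as
  -- b < p, b = 0.
  have hb0 : b = 0 := by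
    have hs := sum_coeff_eq_zero_of_mem_delta (by omega) (hu 1)
    rw [← h1] at hs
    simp at hs
    rw [CharP.cast_eq_zero_iff F p] at hs
    exact Nat.eq_zero_of_dvd_of_lt hs hb
  subst hb0
  have hu0 := hu 0
  rw [← h0] at hu0
  simpa [hk] using hu0

end IsStep

end Prefiltration

/-! ### Reduction to finite subgroups and descent -/

namespace Prefiltration

variable {G : Type*} [Group G] {N : Prefiltration G} {p : ℕ}

/-- The image of K modulo N_{i+1} is finitely generated, abelian and of exponent dividing p, hence
finite. The kernel then has finite index, so it is again finitely generated, and it lies one step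
deeper; n bounds the steps left before N_m = 1. -/
theorem finite_of_fg (hN : ∀ k, (N.term k).Normal) (hp : p.Prime)
    (hpow : ∀ i, 1 ≤ i → ∀ g ∈ N.term i, g ^ p ∈ N.term (i * p)) {m : ℕ} (hm : N.term m = ⊥)
    (n i : ℕ) (hi : 1 ≤ i) (hmi : m ≤ i + n) (K : Subgroup G) (hfg : K.FG) (hK : K ≤ N.term i) :
    Finite K := by
  induction n generalizing i K with
  | zero =>
    have : K = ⊥ := le_bot_iff.1 (hm ▸ hK.trans (N.anti hmi))
    subst this
    infer_instance
  | succ n ih =>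
    have := hN (i + 1)
    let f : K →* G ⧸ N.term (i + 1) := (QuotientGroup.mk' (N.term (i + 1))).comp K.subtype
    have hker : ∀ g : K, g ∈ f.ker ↔ (g : G) ∈ N.term (i + 1) := fun g => by
      simp [f, MonoidHom.mem_ker]
    have hKfg : Group.FG K := (Group.fg_iff_subgroup_fg K).2 hfg
    have hcomm : ∀ a b : f.range, a * b = b * a := by
      rintro ⟨_, a, rfl⟩ ⟨_, b, rfl⟩
      have h1 : ⁅a, b⁆ ∈ f.ker := by
        rw [hker]
        exact N.anti (by omega) (N.commutator_mem (hK a.2) (hK b.2))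
      rw [MonoidHom.mem_ker, map_commutatorElement, commutatorElement_eq_one_iff_mul_comm] at h1
      exact Subtype.ext h1
    have hrfg : Group.FG f.range := Group.fg_range f
    let _ : CommGroup f.range := { (inferInstance : Group f.range) with mul_comm := hcomm }
    have hfin : Finite f.range := by
      refine CommGroup.finite_of_fg_isMulTorsion (G := f.range) ?_
      rintro ⟨_, a, rfl⟩
      refine isOfFinOrder_iff_pow_eq_one.2 ⟨p, hp.pos, Subtype.ext ?_⟩
      have h1 : a ^ p ∈ f.ker := by
        rw [hker]
        exact N.anti (by nlinarith [hp.two_le]) (hpow i hi a (hK a.2))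
      rw [MonoidHom.mem_ker, map_pow] at h1
      exact h1
    have hidx : f.ker.FiniteIndex := Subgroup.finiteIndex_ker f
    have hkfg : Group.FG f.ker := Subgroup.fg_of_index_ne_zero _
    have hkfin : Finite (f.ker.map K.subtype) := by
      refine ih (i + 1) (by omega) (by omega) _ ((Group.fg_iff_subgroup_fg _).1
        (Group.fg_of_surjective (K.subtype.subgroupMap_surjective f.ker))) ?_
      rintro _ ⟨a, ha, rfl⟩
      exact (hker a).1 ha
    have : Finite f.ker :=
      (f.ker.equivMapOfInjective _ K.subtype_injective).toEquiv.finite_iff.2 hkfin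
    exact Finite.of_subgroup_quotient f.ker

theorem exists_isStep (hp : p.Prime)
    (hpow : ∀ i, 1 ≤ i → ∀ g ∈ N.term i, g ^ p ∈ N.term (i * p)) {m : ℕ} (hm : N.term m = ⊥)
    (h1 : N.term 1 = ⊤) {H : Subgroup G} [Finite H] (hH : H ≠ ⊥) :
    ∃ w < m, ∃ K < H, ∃ x, N.IsStep p w K H x := by
  classical
  have hex : ∃ n, ¬ H ≤ N.term n := ⟨m, fun h => hH (le_bot_iff.1 (hm ▸ h))⟩
  obtain ⟨w, hw⟩ : ∃ w, Nat.find hex = w + 1 := by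
    refine ⟨Nat.find hex - 1, ?_⟩
    have : Nat.find hex ≠ 0 := fun h => by
      have := Nat.find_spec hex
      rw [h] at this
      exact this ((h1 ▸ le_top : H ≤ N.term 1).trans (N.anti zero_le_one))
    omega
  have hwH : H ≤ N.term w := not_not.1 (Nat.find_min hex (by omega))
  have hwH' : ¬ H ≤ N.term (w + 1) := hw ▸ Nat.find_spec hex
  have hw1 : 1 ≤ w := by
    by_contra h
    obtain rfl : w = 0 := by omega
    exact hwH' (h1 ▸ le_top)
  have hwm : w < m := by
    by_contra h
    exact hH (le_bot_iff.1 (hm ▸ hwH.trans (N.anti (by omega))))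
  have hfin : {K : Subgroup G | H ⊓ N.term (w + 1) ≤ K ∧ K < H}.Finite := by
    refine (((Set.toFinite (H : Set G)).finite_subsets).preimage
      (SetLike.coe_injective.injOn)).subset ?_
    exact fun K hK => hK.2.le
  -- With w the last index such that H ≤ N_w, K is a maximal proper subgroup of H above H ∩ N_{w+1},
  -- and x is any element of H outside K.
  obtain ⟨K, hK⟩ := hfin.exists_maximal
    ⟨H ⊓ N.term (w + 1), le_rfl, inf_lt_left.2 hwH'⟩
  obtain ⟨hLK, hKH⟩ := hK.prop
  obtain ⟨x, hxH, hxK⟩ := SetLike.exists_of_lt hKH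
  have hmem : ∀ g ∈ H, g ∈ N.term (w + 1) → g ∈ K := fun g hg hg' => hLK ⟨hg, hg'⟩
  -- K is normal in H because [H, H] lies in N_{2w} ≤ N_{w+1}, as w ≥ 1.
  have hconj : ∀ g ∈ H, ∀ k ∈ K, g * k * g⁻¹ ∈ K := by
    intro g hg k hk
    have h2 : ⁅g, k⁆ ∈ K := by
      refine hmem _ ?_ (N.anti (by omega) (N.commutator_mem (hwH hg) (hwH (hKH.le hk))))
      rw [commutatorElement_def]
      exact mul_mem (mul_mem (mul_mem hg (hKH.le hk)) (inv_mem hg)) (inv_mem (hKH.le hk))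
    simpa [commutatorElement_def] using mul_mem h2 hk
  have hxp : x ^ p ∈ N.term (w * p) := hpow w hw1 x (hwH hxH)
  have hxpK : x ^ p ∈ K := hmem _ (pow_mem hxH p) (N.anti (by nlinarith [hp.two_le]) hxp)
  -- D is K⟨x⟩, a subgroup by normality of K in H, and equal to H by maximality of K.
  let D : Subgroup G :=
    { carrier := {g | ∃ b : ℤ, ∃ h ∈ K, g = h * x ^ b}
      one_mem' := ⟨0, 1, one_mem K, by simp⟩
      mul_mem' := by
        rintro _ _ ⟨b, h, hh, rfl⟩ ⟨c, k, hk, rfl⟩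
        refine ⟨b + c, h * (x ^ b * k * (x ^ b)⁻¹),
          mul_mem hh (hconj _ (zpow_mem hxH b) k hk), ?_⟩
        rw [zpow_add]
        group
      inv_mem' := by
        rintro _ ⟨b, h, hh, rfl⟩
        refine ⟨-b, x ^ (-b) * h⁻¹ * (x ^ (-b))⁻¹,
          hconj _ (zpow_mem hxH _) _ (inv_mem hh), ?_⟩
        group }
  have hD : D = H := by
    have hDH : D ≤ H := by
      rintro _ ⟨b, h, hh, rfl⟩
      exact mul_mem (hKH.le hh) (zpow_mem hxH b)
    have hKD : K ≤ D := fun h hh => ⟨0, h, hh, by simp⟩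
    by_contra hne
    exact hxK (hK.le_of_ge ⟨hLK.trans hKD, lt_of_le_of_ne hDH hne⟩ hKD
      ⟨1, 1, one_mem K, by simp⟩)
  refine ⟨w, hwm, K, hKH, x, hw1, hwH, hKH.le, hxH, hmem, hxpK, hxp, ?_, ?_⟩
  · intro b hb hbp hbK
    -- By Bézout, x^b and x^p both in K would put x in K.
    have hcop : (b : ℤ) * Nat.gcdA b p + p * Nat.gcdB b p = 1 := by
      rw [← Nat.gcd_eq_gcd_ab, (Nat.coprime_of_lt_prime hb.ne' hbp hp).symm.gcd_eq_one,
        Nat.cast_one]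
    apply hxK
    rw [← zpow_one x, ← hcop, zpow_add, zpow_mul, zpow_mul, zpow_natCast, zpow_natCast]
    exact mul_mem (zpow_mem hbK _) (zpow_mem hxpK _)
  · intro g hg
    obtain ⟨b, h, hh, rfl⟩ : g ∈ D := hD ▸ hg
    have hp0 : (0 : ℤ) < p := by exact_mod_cast hp.pos
    refine ⟨(b % p).toNat, ?_, h * (x ^ p) ^ (b / p), mul_mem hh (zpow_mem hxpK _), ?_⟩
    · have := Int.emod_lt_of_pos b hp0
      have := Int.emod_nonneg b hp0.ne'
      omega
    · rw [mul_assoc, ← zpow_natCast x p, ← zpow_mul, ← zpow_natCast x (Int.toNat _),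
        Int.toNat_of_nonneg (Int.emod_nonneg b hp0.ne'), ← zpow_add, Int.mul_ediv_add_emod]

/-- Descent on the order of H: each step replaces H by a proper subgroup K while g and m stay the
same, until the subgroup is trivial. -/
theorem eq_one_of_sub_one_mem_delta_of_finite {F : Type*} [Field F] [CharP F p]
    (hN : ∀ k, (N.term k).Normal) (hp : p.Prime)
    (hpow : ∀ i, 1 ≤ i → ∀ g ∈ N.term i, g ^ p ∈ N.term (i * p)) {m : ℕ} (hm : N.term m = ⊥)
    (h1 : N.term 1 = ⊤) (H : Subgroup G) [Finite H] {g : G} (hg : g ∈ H)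
    (hgm : of F G g - 1 ∈ N.delta F H m) : g = 1 := by
  induction hn : Nat.card H using Nat.strong_induction_on generalizing H with
  | _ n ih =>
    by_cases hH : H = ⊥
    · subst hH
      exact Subgroup.mem_bot.1 hg
    obtain ⟨w, hwm, K, hKH, x, hstep⟩ := exists_isStep hp hpow hm h1 hH
    obtain ⟨hgK, hgKm⟩ := hstep.sub_one_mem_delta_of_mem_delta hN hp hwm hg hgm
    have : Finite K := Finite.of_injective _ (Subgroup.inclusion_injective hKH.le)
    refine ih (Nat.card K) ?_ K hgK hgKm rfl
    rw [← hn]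
    exact Set.ncard_lt_ncard hKH (Set.toFinite _)

theorem exists_fg_of_mem_delta {F : Type*} [Field F] {m : ℕ} {y : MonoidAlgebra F G}
    (hy : y ∈ N.delta F ⊤ m) : ∃ K : Subgroup G, K.FG ∧ y ∈ N.delta F K m := by
  induction hy using Submodule.span_induction with
  | mem y hy =>
    obtain ⟨l, hl, hli, rfl⟩ := hy
    refine ⟨Subgroup.closure {g | g ∈ l.map Prod.snd},
      (Subgroup.fg_iff _).2 ⟨_, rfl, List.finite_toSet _⟩,
      Submodule.subset_span ⟨l, fun t ht => ⟨(hl t ht).1, (hl t ht).2.1, ?_⟩, hli, rfl⟩⟩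
    exact Subgroup.subset_closure (List.mem_map_of_mem ht)
  | zero => exact ⟨⊥, Subgroup.FG.bot, zero_mem _⟩
  | add y z _ _ hy hz =>
    obtain ⟨K, hK, hy⟩ := hy
    obtain ⟨L, hL, hz⟩ := hz
    exact ⟨K ⊔ L, hK.sup hL, add_mem (delta_mono le_sup_left m hy) (delta_mono le_sup_right m hz)⟩
  | smul c y _ hy =>
    obtain ⟨K, hK, hy⟩ := hy
    exact ⟨K, hK, Submodule.smul_mem _ c hy⟩

theorem eq_one_of_sub_one_mem_delta {F : Type*} [Field F] [CharP F p]
    (hN : ∀ k, (N.term k).Normal) (hp : p.Prime)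
    (hpow : ∀ i, 1 ≤ i → ∀ g ∈ N.term i, g ^ p ∈ N.term (i * p)) {m : ℕ} (hm : N.term m = ⊥)
    (h1 : N.term 1 = ⊤) {g : G} (hgm : of F G g - 1 ∈ N.delta F ⊤ m) : g = 1 := by
  obtain ⟨K, hK, hgK⟩ := exists_fg_of_mem_delta hgm
  have hL : (K ⊔ Subgroup.closure {g}).FG :=
    hK.sup ((Subgroup.fg_iff _).2 ⟨_, rfl, Set.finite_singleton g⟩)
  have := finite_of_fg hN hp hpow hm m 1 le_rfl (by omega) _ hL (h1 ▸ le_top)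
  exact eq_one_of_sub_one_mem_delta_of_finite hN hp hpow hm h1 (K ⊔ Subgroup.closure {g})
    (le_sup_right (a := K) (Subgroup.mem_closure_singleton_self g)) (delta_mono le_sup_left m hgK)

end Prefiltration

/-! ### Products of normal subgroups and the two inclusions -/

theorem subgroupProduct_eq_iSup {G : Type*} [Group G] {ι : Type*} (H : ι → Subgroup G)
    (hH : ∀ t, (H t).Normal) : subgroupProduct H = ((⨆ t, H t : Subgroup G) : Set G) := by
  classical
  have hfin : ∀ (s : List ι), s.Nodup → ∀ g ∈ (⨆ t ∈ s, H t : Subgroup G),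
      ∃ a : ι → G, (∀ t, a t ∈ H t) ∧ g = (s.map a).prod := by
    intro s
    induction s with
    | nil => exact fun _ g hg => ⟨1, fun t => one_mem _, by simpa using hg⟩
    | cons i s ih =>
      intro hs g hg
      obtain ⟨his, hs⟩ := List.nodup_cons.1 hs
      simp only [List.mem_cons, iSup_or, iSup_sup_eq, iSup_iSup_eq_left] at hg
      have := hH i
      obtain ⟨x, hx, y, hy, rfl⟩ := Subgroup.mem_sup_of_normal_left.1 hg
      obtain ⟨a, ha, rfl⟩ := ih hs y hy
      -- Since i does not occur in s, changing the value at i leaves the product over s intact.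
      refine ⟨Function.update a i x, fun t => ?_, ?_⟩
      · by_cases ht : t = i
        · subst ht
          simpa using hx
        · simpa [ht] using ha t
      · rw [List.map_cons, List.prod_cons, Function.update_self]
        congr 2
        refine List.map_congr_left fun t ht => ?_
        rw [Function.update_of_ne]
        rintro rfl
        exact his ht
  ext g
  constructor
  · rintro ⟨l, a, -, ha, rfl⟩
    refine Subgroup.list_prod_mem _ fun y hy => ?_
    obtain ⟨t, -, rfl⟩ := List.mem_map.1 hy
    exact (le_iSup H t : H t ≤ _) (ha t)
  · intro hg
    obtain ⟨s, hs⟩ : ∃ s : Finset ι, g ∈ (⨆ t ∈ s, H t : Subgroup G) := by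
      rw [iSup_eq_iSup_finset] at hg
      refine (Subgroup.mem_iSup_of_directed (Monotone.directed_le fun s t hst => ?_)).1 hg
      exact biSup_mono fun i hi => hst hi
    obtain ⟨a, ha, rfl⟩ := hfin s.toList s.nodup_toList g (by simpa using hs)
    exact ⟨s.toList, a, s.nodup_toList, ha, rfl⟩

namespace NSeries

variable {G : Type*} [Group G]

theorem term_anti (N : NSeries G) {i j : ℕ} (hi : 1 ≤ i) (hij : i ≤ j) : N.term j ≤ N.term i := by
  induction j, hij using Nat.le_induction with
  | base => exact le_rfl
  | succ j hij ih => exact (N.term_succ_le j (hi.trans hij)).trans ih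

/-- The prefiltration that agrees with a given N-series in all degrees at least `1`. -/
def toPrefiltration (N : NSeries G) : Prefiltration G where
  term i := N.term (max i 1)
  anti i j h := N.term_anti (le_max_right i 1) (max_le_max_right 1 h)
  commutator_le i j := (N.commutator_le _ _ (le_max_right i 1) (le_max_right j 1)).trans
    (N.term_anti (le_max_right _ 1) (by omega))

theorem toPrefiltration_term (N : NSeries G) {i : ℕ} (hi : 1 ≤ i) :
    N.toPrefiltration.term i = N.term i := by
  simp [toPrefiltration, hi]

theorem toPrefiltration_term_zero (N : NSeries G) : N.toPrefiltration.term 0 = ⊤ := N.term_one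

theorem normal_term (N : NSeries G) {i : ℕ} (hi : 1 ≤ i) : (N.term i).Normal :=
  N.toPrefiltration_term hi ▸
    N.toPrefiltration.normal_of_eq_top N.toPrefiltration_term_zero i

theorem lazardSeries_eq (N : NSeries G) (p i : ℕ) :
    N.lazardSeries p i =
      (Subgroup.closure (N.toPrefiltration.lazardGenerators p i) : Set G) := by
  rw [lazardSeries, subgroupProduct_eq_iSup]
  · congr 1
    apply le_antisymm
    · refine iSup_le fun t => (Subgroup.closure_le _).2 ?_
      rintro _ ⟨x, hx, rfl⟩
      exact Subgroup.subset_closure ⟨t.1.1, t.1.2, x, t.2.1, t.2.2,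
        (N.toPrefiltration_term t.2.1).symm ▸ hx, rfl⟩
    · refine (Subgroup.closure_le _).2 ?_
      rintro _ ⟨k, j, x, hk, hi, hx, rfl⟩
      refine le_iSup (fun t : {t : ℕ × ℕ // 1 ≤ t.1 ∧ i ≤ t.1 * p ^ t.2} =>
        powerSubgroup (N.term t.1.1) (p ^ t.1.2)) ⟨(k, j), hk, hi⟩ (Subgroup.subset_closure ?_)
      exact ⟨x, N.toPrefiltration_term hk ▸ hx, rfl⟩
  · rintro ⟨⟨k, j⟩, hk, -⟩
    refine ⟨fun g hg y => ?_⟩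
    have := N.normal_term hk
    induction hg using Subgroup.closure_induction with
    | mem g hg =>
      obtain ⟨x, hx, rfl⟩ := hg
      exact Subgroup.subset_closure ⟨y * x * y⁻¹, this.conj_mem x hx y, by rw [conj_pow]⟩
    | one => simp
    | mul u v _ _ hu hv => simpa using mul_mem hu hv
    | inv u _ hu => simpa [mul_assoc] using inv_mem hu

variable {F : Type*} [Field F] {p : ℕ} [CharP F p]

/-- In characteristic p, x^(p^j) - 1 is the product of p^j factors x - 1, each of weight k. -/
theorem closure_lazardGenerators_le_dimensionSubgroup (N : NSeries G) (hp : p.Prime) (i : ℕ) :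
    Subgroup.closure (N.toPrefiltration.lazardGenerators p i) ≤ N.dimensionSubgroup F i := by
  have : Fact p.Prime := ⟨hp⟩
  have : CharP (MonoidAlgebra F G) p :=
    charP_of_injective_algebraMap (algebraMap F (MonoidAlgebra F G)).injective p
  refine (Subgroup.closure_le _).2 ?_
  rintro _ ⟨k, j, x, hk, hi, hx, rfl⟩
  rw [N.toPrefiltration_term hk] at hx
  refine Submodule.subset_span ⟨List.replicate (p ^ j) (k, x), ?_, ?_, ?_⟩
  · intro t ht
    rw [List.eq_of_mem_replicate ht]
    exact ⟨hk, hx⟩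
  · simpa [mul_comm] using hi
  · rw [List.map_replicate, List.prod_replicate, sub_pow_char_pow_of_commute _ _
      (Commute.one_right (of F G x)), one_pow, map_pow]

theorem mapDomain_mem_delta {Q : Type*} [Group Q] (N : NSeries G) (M : Prefiltration Q)
    (f : G →* Q) (hf : ∀ k, 1 ≤ k → ∀ g ∈ N.term k, f g ∈ M.term k) {i : ℕ}
    {y : MonoidAlgebra F G} (hy : y ∈ N.filtration F i) :
    MonoidAlgebra.mapDomainAlgHom F F f y ∈ M.delta F ⊤ i := by
  induction hy using Submodule.span_induction with
  | mem y hy =>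
    obtain ⟨l, hl, hli, rfl⟩ := hy
    refine Submodule.subset_span ⟨l.map fun t => (t.1, f t.2), ?_, ?_, ?_⟩
    · intro t ht
      obtain ⟨s, hs, rfl⟩ := List.mem_map.1 ht
      exact ⟨(hl s hs).1, hf _ (hl s hs).1 _ (hl s hs).2, Subgroup.mem_top _⟩
    · simpa [Function.comp_def] using hli
    · rw [map_list_prod, List.map_map, List.map_map]
      congr 1
      refine List.map_congr_left fun t _ => ?_
      have h : MonoidAlgebra.mapDomainAlgHom F F f (of F G t.2) = of F Q (f t.2) := by simp
      rw [Function.comp_apply, map_sub, map_one, h, Function.comp_apply]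
  | zero => simp
  | add y z _ _ hy hz => rw [map_add]; exact add_mem hy hz
  | smul c y _ hy => rw [map_smul]; exact Submodule.smul_mem _ _ hy

/-- Modulo the i-th Lazard term, the image M of the Lazard series is p-restricted with M_i = 1. As
N_k lies in the k-th Lazard term, g - 1 maps into Δ_i(M), so g becomes trivial in the quotient. -/
theorem dimensionSubgroup_le_closure_lazardGenerators (N : NSeries G) (hp : p.Prime) (i : ℕ) :
    N.dimensionSubgroup F i ≤ Subgroup.closure (N.toPrefiltration.lazardGenerators p i) := by
  intro g hg
  have h0 := N.toPrefiltration_term_zero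
  have hnormal := N.toPrefiltration.closure_lazardGenerators_normal h0 p i
  set P := N.toPrefiltration.lazard h0 hp
  have hPN : ∀ k, 1 ≤ k → N.term k ≤ P.term k := fun k hk x hx =>
    Subgroup.subset_closure ⟨k, 0, x, hk, by simp, (N.toPrefiltration_term hk).symm ▸ hx, by simp⟩
  set π := QuotientGroup.mk' (Subgroup.closure (N.toPrefiltration.lazardGenerators p i))
  let M : Prefiltration (G ⧸ Subgroup.closure (N.toPrefiltration.lazardGenerators p i)) :=
    { term := fun k => (P.term k).map π
      anti := fun _ _ h => Subgroup.map_mono (P.anti h)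
      commutator_le := fun k l => by
        rw [← Subgroup.map_commutator]
        exact Subgroup.map_mono (P.commutator_le k l) }
  have hM1 : M.term 1 = ⊤ := by
    have : P.term 1 = ⊤ := top_le_iff.1 (N.term_one ▸ hPN 1 le_rfl)
    change (P.term 1).map π = ⊤
    rw [this, ← MonoidHom.range_eq_map, MonoidHom.range_eq_top]
    exact QuotientGroup.mk'_surjective _
  have hMi : M.term i = ⊥ := by
    change (Subgroup.closure (N.toPrefiltration.lazardGenerators p i)).map π = ⊥
    rw [Subgroup.map_eq_bot_iff, QuotientGroup.ker_mk']
  have hgm := mapDomain_mem_delta N M π (fun k hk x hx => ⟨x, hPN k hk hx, rfl⟩) hg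
  rw [map_sub, map_one] at hgm
  have h1 : π g = 1 := by
    refine Prefiltration.eq_one_of_sub_one_mem_delta (F := F)
      (M.normal_of_eq_top (top_le_iff.1 (hM1 ▸ M.anti zero_le_one))) hp ?_ hMi hM1
      (by simpa using hgm)
    rintro k hk _ ⟨x, hx, rfl⟩
    exact ⟨x ^ p, N.toPrefiltration.pow_mem_lazard h0 hp hk hx, map_pow _ _ _⟩
  exact (QuotientGroup.eq_one_iff g).1 h1

end NSeries

theorem mainTheorem5 {G : Type*} [Group G] (N : NSeries G) (F : Type*) [Field F]
    (p : ℕ) (hp : 0 < p) [CharP F p] (i : ℕ) (hi : 1 ≤ i) :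
    (N.dimensionSubgroup F i : Set G) = N.lazardSeries p i := by
  have hp' : p.Prime := (CharP.char_is_prime_or_zero F p).resolve_right hp.ne'
  rw [N.lazardSeries_eq, SetLike.coe_set_eq]
  exact le_antisymm (N.dimensionSubgroup_le_closure_lazardGenerators hp' i)
    (N.closure_lazardGenerators_le_dimensionSubgroup hp' i)
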